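/- Let $\mathbb{H}$ be a complex Hilbert space, let $\Omega$ be a locally compact Hausdorff space with a finite Radon measure $\mu$, and let $0<a\le b$. Let $(A_t)_{t\in\Omega}$ and $(B_t)_{t\in\Omega}$ be norm-continuous fields of strictly positive operators in $B(\mathbb{H})$ whose spectra all lie in $[a,b]$, and let $(W_t)_{t\in\Omega}$ be a norm-continuous field of positive operators in $B(\mathbb{H})$ such that $t\mapsto\|W_t\|$ is $\mu$-integrable. Let $\sigma$ be an operator mean on the positive operators of $B(\mathbb{H})$, that is, a binary operation on positive operators such that, for all positive operators: (i) $A\le C$ and $B\le D$ imply $A\,\sigma\,B\le C\,\sigma\,D$; (ii) $C(A\,\sigma\,B)C\le (CAC)\,\sigma\,(CBC)$; (iii) if $A_n\downarrow A$ and $B_n\downarrow B$ (decreasing sequences converging strongly), then $A_n\,\sigma\,B_n\downarrow A\,\sigma\,B$; (iv) $A\,\sigma\,A=A$. Let $f:[0,\infty)\to[0,\infty)$ be its representing function, i.e. the continuous operator monotone function with $f(A)=I\,\sigma\,A$ for all $A\ge 0$, and suppose that $f$ is super-multiplicative: $f(xy)\ge f(x)f(y)$ for all $x,y\ge 0$.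 Then $t\mapsto W_t$, $t\mapsto W_t^{1/2}(A_t\,\sigma\,B_t)W_t^{1/2}$ and $t\mapsto W_t^{1/2}(A_t^{-1}\,\sigma\,B_t^{-1})W_t^{1/2}$ are Bochner integrable, and $$\int_\Omega W_t^{1/2}(A_t\,\sigma\,B_t)W_t^{1/2}\,d\mu(t)\;\otimes_s\;\int_\Omega W_t^{1/2}(A_t^{-1}\,\sigma\,B_t^{-1})W_t^{1/2}\,d\mu(t)\;\le\;\frac{a^2+b^2}{2ab}\left(\int_\Omega W_t\,d\mu(t)\right)^{\otimes 2},$$ where $X\otimes_s Y=\tfrac12(X\otimes Y+Y\otimes X)$ and $X^{\otimes 2}=X\otimes X$ are operators on the Hilbert space tensor product $\mathbb{H}\otimes\mathbb{H}$. -/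

import Mathlib

open MeasureTheory Filter Topology
open scoped TensorProduct

noncomputable section

namespace KantorovichMean

/-- The Hilbert space tensor product `H ⊗ H`: the completion of the algebraic tensor product for
the inner product with `⟪x ⊗ y, x' ⊗ y'⟫ = ⟪x, x'⟫ * ⟪y, y'⟫`. -/
abbrev HilbertTensor (H : Type*) [NormedAddCommGroup H] [InnerProductSpace ℂ H] : Type _ :=
  UniformSpace.Completion (H ⊗[ℂ] H)

variable {H : Type*} [NormedAddCommGroup H] [InnerProductSpace ℂ H]

/-- The tensor product `A ⊗ B` of bounded operators, acting on the Hilbert space `H ⊗ H`: the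
continuous extension of `x ⊗ y ↦ A x ⊗ B y`. -/
def opTensor (A B : H →L[ℂ] H) : HilbertTensor H →L[ℂ] HilbertTensor H :=
  (TensorProduct.mapL A B).completion

/-- The symmetrized tensor product `A ⊗ₛ B = (A ⊗ B + B ⊗ A) / 2`. -/
def symTensor (A B : H →L[ℂ] H) : HilbertTensor H →L[ℂ] HilbertTensor H :=
  (1 / 2 : ℂ) • (opTensor A B + opTensor B A)

/-- `X n ↓ L`: the sequence `X` is decreasing and converges strongly to `L`. -/
def DecreasesTo (X : ℕ → H →L[ℂ] H) (L : H →L[ℂ] H) : Prop :=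
  Antitone X ∧ ∀ x : H, Tendsto (fun n => X n x) atTop (𝓝 (L x))

/-- An operator connection on the positive operators of `B(H)`. The operation is written as a
total function on `B(H)`; only its values at pairs of positive operators matter. -/
structure IsConnection (σ : (H →L[ℂ] H) → (H →L[ℂ] H) → (H →L[ℂ] H)) : Prop where
  /-- the operation takes values in the positive operators -/
  nonneg : ∀ A B, 0 ≤ A → 0 ≤ B → 0 ≤ σ A B
  /-- joint monotonicity -/
  mono : ∀ A B C D, 0 ≤ A → 0 ≤ B → 0 ≤ C → 0 ≤ D → A ≤ C → B ≤ D → σ A B ≤ σ C D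
  /-- transformer inequality -/
  transformer : ∀ A B C, 0 ≤ A → 0 ≤ B → 0 ≤ C → C * σ A B * C ≤ σ (C * A * C) (C * B * C)
  /-- joint continuity from above -/
  continuous_above : ∀ (X Y : ℕ → H →L[ℂ] H) (A B : H →L[ℂ] H),
    (∀ n, 0 ≤ X n) → (∀ n, 0 ≤ Y n) → 0 ≤ A → 0 ≤ B → DecreasesTo X A → DecreasesTo Y B →
      DecreasesTo (fun n => σ (X n) (Y n)) (σ A B)

/-- An operator mean: a connection with the fixed point property `A σ A = A`. -/
structure IsOperatorMean (σ : (H →L[ℂ] H) → (H →L[ℂ] H) → (H →L[ℂ] H)) : Prop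
    extends IsConnection σ where
  fixed_point : ∀ A, 0 ≤ A → σ A A = A

/-- `f` is the representing function of `σ`: the operator monotone function
`f : [0,∞) → [0,∞)` with `f(A) = I σ A` for all positive `A`, where `f(A)` is given by the
continuous functional calculus. Only the values of `f` on `[0,∞)` matter. -/
structure IsRepresentingFunction [CompleteSpace H]
    (σ : (H →L[ℂ] H) → (H →L[ℂ] H) → (H →L[ℂ] H)) (f : ℝ → ℝ) : Prop where
  continuousOn : ContinuousOn f (Set.Ici 0)
  nonneg : ∀ x, 0 ≤ x → 0 ≤ f x
  operatorMonotone : ∀ A B : H →L[ℂ] H, 0 ≤ A → 0 ≤ B → A ≤ B → cfc f A ≤ cfc f B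
  apply_eq : ∀ A : H →L[ℂ] H, 0 ≤ A → cfc f A = σ 1 A

/-- Super-multiplicativity on `[0,∞)`. -/
def SuperMultiplicative (f : ℝ → ℝ) : Prop :=
  ∀ x y : ℝ, 0 ≤ x → 0 ≤ y → f x * f y ≤ f (x * y)

/-- The weighted operator `W^{1/2} T W^{1/2}`. -/
def weighted [CompleteSpace H] (W T : H →L[ℂ] H) : H →L[ℂ] H :=
  CFC.sqrt W * T * CFC.sqrt W

end KantorovichMean

end

/-!
Write `P t = A t σ B t` and `Q t = (A t)⁻¹ σ (B t)⁻¹`. The whole inequality rests on two facts.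

* `a ≤ P t ≤ b`, by monotonicity of `σ` and `σ c c = c` (`IsOperatorMean.bounds`).
* `Q t ≤ (P t)⁻¹` (`IsRepresentingFunction.mean_ringInverse_le`). Indeed
  `A σ B = A^{1/2} f(C) A^{1/2}` with `C = A^{-1/2} B A^{-1/2}`, because the transformer inequality
  is an equality at invertible weights; hence `A⁻¹ σ B⁻¹ = A^{-1/2} f(C⁻¹) A^{-1/2}`, and
  super-multiplicativity gives `f(x⁻¹) f(x) ≤ f(1) = 1`.

Consequently `P s ⊗ Q t + Q s ⊗ P t ≤ Z + Z⁻¹` with `Z = P s ⊗ (P t)⁻¹`, an operator with spectrum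
in `[a / b, b / a]`, and so the sum is at most `b / a + a / b`
(`IsTensorMap.add_le_algebraMap`). Conjugating by `(W s)^{1/2} ⊗ (W t)^{1/2}` inserts the weights,
and integrating the resulting pointwise inequality in `t` and then in `s` gives the claim
(`IsTensorMap.integral_le`). The mean `σ` is only ever used on `B(H)` itself, so it need not be
extended to `H ⊗ H`, and the dimension of `H` plays no role.

For integrability, the formula for `A σ B` and the continuity of the functional calculus in the
operator show that the fields are norm continuous and that the means are bounded. A norm continuous
field is strongly measurable because a finite regular measure is carried by a σ-compact set.
-/

namespace KantorovichMean
variable {H : Type*} [NormedAddCommGroup H] [InnerProductSpace ℂ H]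

/-! ### Tensor products of operators on the completed tensor product -/

theorem opTensor_coe (A B : H →L[ℂ] H) (x : H ⊗[ℂ] H) :
    opTensor A B (x : HilbertTensor H) = (TensorProduct.mapL A B x : H ⊗[ℂ] H) :=
  ContinuousLinearMap.completion_apply_coe _ x

/-- Operators on the completed tensor product are determined by the algebraic tensors. -/
theorem ext_on_tensors {S T : HilbertTensor H →L[ℂ] HilbertTensor H}
    (h : ∀ x : H ⊗[ℂ] H, S x = T x) : S = T := by
  ext z
  induction z using UniformSpace.Completion.induction_on with
  | hp => exact isClosed_eq S.continuous T.continuous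
  | ih x => exact h x

theorem opTensor_add_left (A₁ A₂ B : H →L[ℂ] H) :
    opTensor (A₁ + A₂) B = opTensor A₁ B + opTensor A₂ B :=
  ext_on_tensors fun x => by
    simp only [add_apply, opTensor_coe, TensorProduct.mapL_add_left,
      UniformSpace.Completion.coe_add]

theorem opTensor_add_right (A B₁ B₂ : H →L[ℂ] H) :
    opTensor A (B₁ + B₂) = opTensor A B₁ + opTensor A B₂ :=
  ext_on_tensors fun x => by
    simp only [add_apply, opTensor_coe, TensorProduct.mapL_add_right,
      UniformSpace.Completion.coe_add]

theorem opTensor_smul_left (c : ℂ) (A B : H →L[ℂ] H) :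
    opTensor (c • A) B = c • opTensor A B :=
  ext_on_tensors fun x => by
    simp only [smul_apply, opTensor_coe, TensorProduct.mapL_smul_left,
      UniformSpace.Completion.coe_smul]

theorem opTensor_smul_right (c : ℂ) (A B : H →L[ℂ] H) :
    opTensor A (c • B) = c • opTensor A B :=
  ext_on_tensors fun x => by
    simp only [smul_apply, opTensor_coe, TensorProduct.mapL_smul_right,
      UniformSpace.Completion.coe_smul]

theorem opTensor_mul (A₁ A₂ B₁ B₂ : H →L[ℂ] H) :
    opTensor (A₁ * A₂) (B₁ * B₂) = opTensor A₁ B₁ * opTensor A₂ B₂ :=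
  ext_on_tensors fun x => by
    simp only [mul_apply_eq_comp, opTensor_coe, TensorProduct.mapL_mul]

theorem opTensor_one : opTensor (1 : H →L[ℂ] H) 1 = 1 :=
  ext_on_tensors fun x => by
    rw [opTensor_coe]
    change ((TensorProduct.mapL (.id ℂ H) (.id ℂ H) x : H ⊗[ℂ] H) : HilbertTensor H) = x
    rw [TensorProduct.mapL_id_id]; rfl

theorem norm_opTensor_le (A B : H →L[ℂ] H) : ‖opTensor A B‖ ≤ ‖A‖ * ‖B‖ := by
  refine ContinuousLinearMap.opNorm_le_bound _ (by positivity) fun z => ?_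
  induction z using UniformSpace.Completion.induction_on with
  | hp => exact isClosed_le (by fun_prop) (by fun_prop)
  | ih x =>
    rw [opTensor_coe, UniformSpace.Completion.norm_coe, UniformSpace.Completion.norm_coe]
    exact (ContinuousLinearMap.le_opNorm _ x).trans
      (mul_le_mul_of_nonneg_right (TensorProduct.norm_mapL_le A B) (norm_nonneg x))

variable [CompleteSpace H]

theorem inner_mapL_left (A B : H →L[ℂ] H) (x y : H ⊗[ℂ] H) :
    inner ℂ (TensorProduct.mapL (star A) (star B) x) y =
      inner ℂ x (TensorProduct.mapL A B y) := by
  induction x with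
  | zero => simp
  | add x₁ x₂ h₁ h₂ => simp only [map_add, inner_add_left, h₁, h₂]
  | tmul u v =>
    induction y with
    | zero => simp
    | add y₁ y₂ h₁ h₂ => simp only [map_add, inner_add_right, h₁, h₂]
    | tmul u' v' =>
      simp only [TensorProduct.mapL_tmul, TensorProduct.inner_tmul,
        ContinuousLinearMap.star_eq_adjoint, ContinuousLinearMap.adjoint_inner_left]

theorem star_opTensor (A B : H →L[ℂ] H) :
    star (opTensor A B) = opTensor (star A) (star B) := by
  rw [ContinuousLinearMap.star_eq_adjoint]
  refine ((ContinuousLinearMap.eq_adjoint_iff _ _).2 fun z w => ?_).symm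
  induction z, w using UniformSpace.Completion.induction_on₂ with
  | hp => exact isClosed_eq (by fun_prop) (by fun_prop)
  | ih x y =>
    rw [opTensor_coe, opTensor_coe, UniformSpace.Completion.inner_coe,
      UniformSpace.Completion.inner_coe, inner_mapL_left]

theorem algebraMap_eq_coe_smul {E : Type*} [NormedAddCommGroup E] [InnerProductSpace ℂ E] (r : ℝ) :
    algebraMap ℝ (E →L[ℂ] E) r = (r : ℂ) • 1 := by
  rw [Algebra.algebraMap_eq_smul_one, ← Complex.coe_smul]

/-- Abstract form of `(A, B) ↦ A ⊗ B`: a bounded unital bilinear map into the operators on some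
Hilbert space `K`, multiplicative and compatible with adjoints in both variables jointly. Working
with an arbitrary `K` keeps the concrete structure of the completed tensor product out of the
C⋆-algebra arguments. -/
structure IsTensorMap {K : Type*} [NormedAddCommGroup K] [InnerProductSpace ℂ K] [CompleteSpace K]
    (τ : (H →L[ℂ] H) → (H →L[ℂ] H) → (K →L[ℂ] K)) : Prop where
  add_left : ∀ A₁ A₂ B, τ (A₁ + A₂) B = τ A₁ B + τ A₂ B
  add_right : ∀ A B₁ B₂, τ A (B₁ + B₂) = τ A B₁ + τ A B₂
  smul_left : ∀ (c : ℂ) A B, τ (c • A) B = c • τ A B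
  smul_right : ∀ (c : ℂ) A B, τ A (c • B) = c • τ A B
  map_mul : ∀ A₁ A₂ B₁ B₂, τ (A₁ * A₂) (B₁ * B₂) = τ A₁ B₁ * τ A₂ B₂
  map_one : τ 1 1 = 1
  map_star : ∀ A B, star (τ A B) = τ (star A) (star B)
  norm_le : ∀ A B, ‖τ A B‖ ≤ ‖A‖ * ‖B‖

theorem isTensorMap_opTensor : IsTensorMap (K := HilbertTensor H) (opTensor (H := H)) where
  add_left := opTensor_add_left
  add_right := opTensor_add_right
  smul_left := opTensor_smul_left
  smul_right := opTensor_smul_right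
  map_mul := opTensor_mul
  map_one := opTensor_one
  map_star := star_opTensor
  norm_le := norm_opTensor_le

namespace IsTensorMap

variable {K : Type*} [NormedAddCommGroup K] [InnerProductSpace ℂ K] [CompleteSpace K]
  {τ : (H →L[ℂ] H) → (H →L[ℂ] H) → (K →L[ℂ] K)}

/-- The bounded linear map `B ↦ A ⊗ B`; as such it commutes with Bochner integration. -/
noncomputable def right (hτ : IsTensorMap τ) (A : H →L[ℂ] H) : (H →L[ℂ] H) →L[ℂ] (K →L[ℂ] K) :=
  LinearMap.mkContinuous
    { toFun := τ A
      map_add' := hτ.add_right A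
      map_smul' := fun c B => hτ.smul_right c A B } ‖A‖ (hτ.norm_le A)

/-- The bounded linear map `A ↦ A ⊗ B`; as such it commutes with Bochner integration. -/
noncomputable def left (hτ : IsTensorMap τ) (B : H →L[ℂ] H) : (H →L[ℂ] H) →L[ℂ] (K →L[ℂ] K) :=
  LinearMap.mkContinuous
    { toFun := fun A => τ A B
      map_add' := fun A₁ A₂ => hτ.add_left A₁ A₂ B
      map_smul' := fun c A => hτ.smul_left c A B } ‖B‖ fun A =>
        (hτ.norm_le A B).trans_eq (mul_comm _ _)

theorem sub_left (hτ : IsTensorMap τ) (A₁ A₂ B : H →L[ℂ] H) :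
    τ (A₁ - A₂) B = τ A₁ B - τ A₂ B :=
  map_sub (hτ.left B) A₁ A₂

theorem sub_right (hτ : IsTensorMap τ) (A B₁ B₂ : H →L[ℂ] H) :
    τ A (B₁ - B₂) = τ A B₁ - τ A B₂ :=
  map_sub (hτ.right A) B₁ B₂

theorem isSelfAdjoint (hτ : IsTensorMap τ) {A B : H →L[ℂ] H} (hA : IsSelfAdjoint A)
    (hB : IsSelfAdjoint B) : IsSelfAdjoint (τ A B) := by
  rw [IsSelfAdjoint, hτ.map_star, hA.star_eq, hB.star_eq]

/-- `A ⊗ B` is the square of the self-adjoint operator `√A ⊗ √B`. -/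
theorem nonneg (hτ : IsTensorMap τ) {A B : H →L[ℂ] H} (hA : 0 ≤ A) (hB : 0 ≤ B) :
    0 ≤ τ A B := by
  rw [← CFC.sqrt_mul_sqrt_self A, ← CFC.sqrt_mul_sqrt_self B, hτ.map_mul]
  exact (hτ.isSelfAdjoint (CFC.sqrt_nonneg A).isSelfAdjoint
    (CFC.sqrt_nonneg B).isSelfAdjoint).mul_self_nonneg

theorem mono (hτ : IsTensorMap τ) {A B C D : H →L[ℂ] H} (hB : 0 ≤ B) (hC : 0 ≤ C)
    (hAC : A ≤ C) (hBD : B ≤ D) : τ A B ≤ τ C D := by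
  refine le_trans (b := τ C B) ?_ ?_
  · rw [← sub_nonneg, ← hτ.sub_left]
    exact hτ.nonneg (sub_nonneg.2 hAC) hB
  · rw [← sub_nonneg, ← hτ.sub_right]
    exact hτ.nonneg hC (sub_nonneg.2 hBD)

theorem apply_algebraMap (hτ : IsTensorMap τ) (r s : ℝ) :
    τ (algebraMap ℝ _ r) (algebraMap ℝ _ s) = algebraMap ℝ _ (r * s) := by
  simp only [algebraMap_eq_coe_smul, hτ.smul_left, hτ.smul_right, hτ.map_one,
    smul_smul, Complex.ofReal_mul]

theorem apply_weighted (hτ : IsTensorMap τ) (W V S T : H →L[ℂ] H) :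
    τ (weighted W S) (weighted V T) =
      τ (CFC.sqrt W) (CFC.sqrt V) * τ S T * τ (CFC.sqrt W) (CFC.sqrt V) := by
  simp only [weighted, hτ.map_mul]

end IsTensorMap

/-! ### Order bounds in a C⋆-algebra -/

theorem ringInverse_algebraMap {R : Type*} [Ring R] [Algebra ℝ R] {r : ℝ} (hr : r ≠ 0) :
    Ring.inverse (algebraMap ℝ R r) = algebraMap ℝ R r⁻¹ :=
  Ring.inverse_unit (Units.map (algebraMap ℝ R).toMonoidHom (Units.mk0 r hr))

section CStar

variable {𝒜 : Type*} [CStarAlgebra 𝒜] [PartialOrder 𝒜] [StarOrderedRing 𝒜]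

theorem isStrictlyPositive_of_algebraMap_le {r : ℝ} (hr : 0 < r) {z : 𝒜}
    (h : algebraMap ℝ 𝒜 r ≤ z) : IsStrictlyPositive z := by
  refine IsStrictlyPositive.of_le ⟨?_, ?_⟩ h
  · exact algebraMap_nonneg 𝒜 hr.le
  · exact (IsUnit.mk0 r hr.ne').map (algebraMap ℝ 𝒜)

theorem algebraMap_le_ringInverse {r : ℝ} (hr : 0 < r) {z : 𝒜} (hz : IsStrictlyPositive z)
    (h : z ≤ algebraMap ℝ 𝒜 r) : algebraMap ℝ 𝒜 r⁻¹ ≤ Ring.inverse z := by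
  rw [← ringInverse_algebraMap hr.ne']
  exact CStarAlgebra.ringInverse_le_ringInverse h hz

theorem ringInverse_le_algebraMap {r : ℝ} (hr : 0 < r) {z : 𝒜}
    (h : algebraMap ℝ 𝒜 r ≤ z) : Ring.inverse z ≤ algebraMap ℝ 𝒜 r⁻¹ := by
  rw [← ringInverse_algebraMap hr.ne']
  exact CStarAlgebra.ringInverse_le_ringInverse h
    (isStrictlyPositive_of_algebraMap_le hr le_rfl)

theorem spectrum_subset_Icc_of_le {r s : ℝ} {z : 𝒜} (hz : IsSelfAdjoint z)
    (hr : algebraMap ℝ 𝒜 r ≤ z) (hs : z ≤ algebraMap ℝ 𝒜 s) : spectrum ℝ z ⊆ Set.Icc r s :=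
  fun x hx => ⟨(algebraMap_le_iff_le_spectrum hz).1 hr x hx,
    (le_algebraMap_iff_spectrum_le hz).1 hs x hx⟩

/-- The scalar inequality `x + x⁻¹ ≤ r + r⁻¹` on `[r⁻¹, r]`, lifted by the functional calculus. -/
theorem add_ringInverse_le {r : ℝ} (hr : 0 < r) {z : 𝒜}
    (h₁ : algebraMap ℝ 𝒜 r⁻¹ ≤ z) (h₂ : z ≤ algebraMap ℝ 𝒜 r) :
    z + Ring.inverse z ≤ algebraMap ℝ 𝒜 (r + r⁻¹) := by
  have hz : IsStrictlyPositive z := isStrictlyPositive_of_algebraMap_le (inv_pos.2 hr) h₁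
  have hsa : IsSelfAdjoint z := hz.nonneg.isSelfAdjoint
  have hspec := spectrum_subset_Icc_of_le hsa h₁ h₂
  have hne : ∀ x ∈ spectrum ℝ z, x ≠ 0 := fun x hx => (hz.spectrum_pos hx).ne'
  have hinv : ContinuousOn (fun x : ℝ => x⁻¹) (spectrum ℝ z) := continuousOn_inv₀.mono hne
  have key : z + Ring.inverse z = cfc (fun x : ℝ => x + x⁻¹) z := by
    rw [cfc_add z (fun x : ℝ => x) (fun x => x⁻¹), cfc_inv (fun x : ℝ => x) z hne,
      cfc_id' ℝ z]
  rw [key]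
  refine cfc_le_algebraMap _ _ _ (fun x hx => ?_) (continuousOn_id.add hinv) hsa
  obtain ⟨hx₁, hx₂⟩ := hspec hx
  have hx : 0 < x := (inv_pos.2 hr).trans_le hx₁
  have : 0 ≤ (r - x) * (x * r - 1) :=
    mul_nonneg (sub_nonneg.2 hx₂) (sub_nonneg.2 ((inv_le_iff_one_le_mul₀ hr).1 hx₁))
  have e : r + r⁻¹ - (x + x⁻¹) = (r - x) * (x * r - 1) / (x * r) := by
    field_simp
    ring
  rw [← sub_nonneg, e]
  positivity

end CStar

/-! ### Operator means at invertible operators -/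

variable {H : Type*} [NormedAddCommGroup H] [InnerProductSpace ℂ H] [CompleteSpace H]
  {σ : (H →L[ℂ] H) → (H →L[ℂ] H) → (H →L[ℂ] H)} {f : ℝ → ℝ}

/-- At an invertible weight the transformer inequality is an equality, since it can be applied
to the inverse weight as well. -/
theorem IsConnection.conjSqrt_apply (hσ : IsConnection σ) {C A B : H →L[ℂ] H}
    (hC : IsStrictlyPositive C) (hA : 0 ≤ A) (hB : 0 ≤ B) :
    CFC.conjSqrt C (σ A B) = σ (CFC.conjSqrt C A) (CFC.conjSqrt C B) := by
  have conj_nonneg : ∀ {X Y : H →L[ℂ] H}, 0 ≤ Y → 0 ≤ CFC.conjSqrt X Y := fun {X Y} h => by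
    simpa using CFC.conjSqrt_le_conjSqrt (c := X) h
  have trans : ∀ {X Y Z : H →L[ℂ] H}, 0 ≤ Y → 0 ≤ Z →
      CFC.conjSqrt X (σ Y Z) ≤ σ (CFC.conjSqrt X Y) (CFC.conjSqrt X Z) :=
    fun {X Y Z} hY hZ => hσ.transformer Y Z (CFC.sqrt X) hY hZ (CFC.sqrt_nonneg X)
  refine le_antisymm (trans hA hB) ?_
  have h := CFC.conjSqrt_le_conjSqrt (c := C)
    (trans (X := Ring.inverse C) (conj_nonneg (X := C) hA) (conj_nonneg (X := C) hB))
  rwa [CFC.conjSqrt_conjSqrt_ringInverse C _ hC, CFC.conjSqrt_ringInverse_conjSqrt C _ hC,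
    CFC.conjSqrt_ringInverse_conjSqrt C _ hC] at h

/-- `A σ B = A^{1/2} f(A^{-1/2} B A^{-1/2}) A^{1/2}` for invertible `A`. -/
theorem IsRepresentingFunction.apply_of_isStrictlyPositive (hf : IsRepresentingFunction σ f)
    (hσ : IsConnection σ) {A B : H →L[ℂ] H} (hA : IsStrictlyPositive A) (hB : 0 ≤ B) :
    σ A B = CFC.conjSqrt A (cfc f (CFC.conjSqrt (Ring.inverse A) B)) := by
  have hC : 0 ≤ CFC.conjSqrt (Ring.inverse A) B := by
    simpa using CFC.conjSqrt_le_conjSqrt (c := Ring.inverse A) hB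
  rw [hf.apply_eq _ hC, hσ.conjSqrt_apply hA zero_le_one hC, CFC.conjSqrt_one A hA.nonneg,
    CFC.conjSqrt_conjSqrt_ringInverse A _ hA]

theorem IsOperatorMean.bounds (hσ : IsOperatorMean σ) {a b : ℝ} (ha : 0 ≤ a) {A B : H →L[ℂ] H}
    (haA : algebraMap ℝ _ a ≤ A) (hAb : A ≤ algebraMap ℝ _ b)
    (haB : algebraMap ℝ _ a ≤ B) (hBb : B ≤ algebraMap ℝ _ b) :
    algebraMap ℝ _ a ≤ σ A B ∧ σ A B ≤ algebraMap ℝ _ b := by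
  have h0 : (0 : H →L[ℂ] H) ≤ algebraMap ℝ _ a := algebraMap_nonneg _ ha
  have hA := h0.trans haA
  have hB := h0.trans haB
  constructor
  · simpa only [hσ.fixed_point _ h0] using hσ.mono _ _ _ _ h0 h0 hA hB haA haB
  · have hb := hA.trans hAb
    simpa only [hσ.fixed_point _ hb] using hσ.mono _ _ _ _ hA hB hb hb hAb hBb

/-- On the trivial space `f` is unconstrained, hence the nontriviality assumption. -/
theorem IsRepresentingFunction.apply_one [Nontrivial H] (hf : IsRepresentingFunction σ f)
    (hσ : IsOperatorMean σ) : f 1 = 1 := by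
  have h := hf.apply_eq 1 zero_le_one
  rw [hσ.fixed_point 1 zero_le_one, cfc_apply_one] at h
  exact (algebraMap ℝ (H →L[ℂ] H)).injective (by rw [h, map_one])

/-- Super-multiplicativity enters only through `f x * f x⁻¹ ≤ f 1 = 1`. -/
theorem IsRepresentingFunction.mean_ringInverse_le (hf : IsRepresentingFunction σ f)
    (hσ : IsOperatorMean σ) (hfsm : SuperMultiplicative f) {A B : H →L[ℂ] H}
    (hA : IsStrictlyPositive A) (hB : IsStrictlyPositive B) (hP : IsStrictlyPositive (σ A B)) :
    σ (Ring.inverse A) (Ring.inverse B) ≤ Ring.inverse (σ A B) := by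
  have hAi := hA.ringInverse
  rw [hf.apply_of_isStrictlyPositive hσ.toIsConnection hA hB.nonneg] at hP ⊢
  rw [hf.apply_of_isStrictlyPositive hσ.toIsConnection hAi hB.ringInverse.nonneg,
    CFC.ringInverse_conjSqrt A _ hA, ← CFC.ringInverse_conjSqrt _ _ hAi]
  refine CFC.conjSqrt_le_conjSqrt ?_
  have hC : IsStrictlyPositive (CFC.conjSqrt (Ring.inverse A) B) :=
    (CFC.isStrictlyPositive_conjSqrt_iff _ _ hAi).2 hB
  generalize CFC.conjSqrt (Ring.inverse A) B = C at hP hC ⊢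
  have hfC : IsStrictlyPositive (cfc f C) := (CFC.isStrictlyPositive_conjSqrt_iff _ _ hA).1 hP
  have hsa : IsSelfAdjoint C := hC.nonneg.isSelfAdjoint
  have hpos : ∀ x ∈ spectrum ℝ C, 0 < x := fun x hx => hC.spectrum_pos hx
  have hcont : ContinuousOn f (spectrum ℝ C) := hf.continuousOn.mono fun x hx => (hpos x hx).le
  have hfpos : ∀ x ∈ spectrum ℝ C, 0 < f x := fun x hx =>
    hfC.spectrum_pos (by rw [cfc_map_spectrum f C hsa hcont]; exact Set.mem_image_of_mem f hx)
  have hinv : ContinuousOn (fun x : ℝ => x⁻¹) (spectrum ℝ C) :=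
    continuousOn_inv₀.mono fun x hx => (hpos x hx).ne'
  have hcont' : ContinuousOn f ((fun x : ℝ => x⁻¹) '' spectrum ℝ C) := by
    refine hf.continuousOn.mono ?_
    rintro _ ⟨x, hx, rfl⟩
    exact (inv_pos.2 (hpos x hx)).le
  have e : Ring.inverse C = cfc (fun x : ℝ => x⁻¹) C := by
    rw [cfc_inv (fun x : ℝ => x) C fun x hx => (hpos x hx).ne', cfc_id' ℝ C]
  rw [e, ← cfc_comp' f (fun x : ℝ => x⁻¹) C hcont' hinv,
    ← cfc_inv f C fun x hx => (hfpos x hx).ne']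
  refine cfc_mono (fun x hx => ?_) (hcont'.comp hinv (Set.mapsTo_image _ _))
    (hcont.inv₀ fun x hx => (hfpos x hx).ne')
  -- A spectral value exists only if `H` is nontrivial, which is what `f 1 = 1` needs.
  have : Nontrivial H := by
    by_contra hH
    rw [not_nontrivial_iff_subsingleton] at hH
    have : Subsingleton (H →L[ℂ] H) := ⟨fun S T => by ext v; exact Subsingleton.elim _ _⟩
    simp [spectrum.of_subsingleton] at hx
  have hx0 := hpos x hx
  rw [← one_div (f x), le_div_iff₀ (hfpos x hx)]
  simpa [hx0.ne', hf.apply_one hσ] using hfsm x⁻¹ x (inv_pos.2 hx0).le hx0.le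

/-! ### The Kantorovich inequality for tensor products of means -/

namespace IsTensorMap

variable {K : Type*} [NormedAddCommGroup K] [InnerProductSpace ℂ K] [CompleteSpace K]
  {τ : (H →L[ℂ] H) → (H →L[ℂ] H) → (K →L[ℂ] K)}

theorem apply_ringInverse (hτ : IsTensorMap τ) {A B : H →L[ℂ] H} (hA : IsUnit A) (hB : IsUnit B) :
    τ (Ring.inverse A) (Ring.inverse B) = Ring.inverse (τ A B) := by
  refine (Ring.inverse_unit (⟨τ A B, τ (Ring.inverse A) (Ring.inverse B), ?_, ?_⟩ :
    (K →L[ℂ] K)ˣ)).symm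
  · rw [← hτ.map_mul, Ring.mul_inverse_cancel _ hA, Ring.mul_inverse_cancel _ hB, hτ.map_one]
  · rw [← hτ.map_mul, Ring.inverse_mul_cancel _ hA, Ring.inverse_mul_cancel _ hB, hτ.map_one]

/-- The left side is at most `Z + Z⁻¹` for `Z = P ⊗ P'⁻¹`, whose spectrum lies in
`[a / b, b / a]`. -/
theorem add_le_algebraMap (hτ : IsTensorMap τ) {a b : ℝ} (ha : 0 < a) (hb : 0 < b)
    {P P' Q Q' : H →L[ℂ] H} (haP : algebraMap ℝ _ a ≤ P) (hPb : P ≤ algebraMap ℝ _ b)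
    (haP' : algebraMap ℝ _ a ≤ P') (hPb' : P' ≤ algebraMap ℝ _ b)
    (hQP : Q ≤ Ring.inverse P) (hQ' : 0 ≤ Q') (hQP' : Q' ≤ Ring.inverse P') :
    τ P Q' + τ Q P' ≤ algebraMap ℝ _ (b / a + a / b) := by
  have hP := isStrictlyPositive_of_algebraMap_le ha haP
  have hP' := isStrictlyPositive_of_algebraMap_le ha haP'
  have hinv : τ (Ring.inverse P) P' = Ring.inverse (τ P (Ring.inverse P')) := by
    rw [← hτ.apply_ringInverse hP.isUnit hP'.ringInverse.isUnit, Ring.inverse_inverse hP'.isUnit]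
  calc τ P Q' + τ Q P'
      ≤ τ P (Ring.inverse P') + Ring.inverse (τ P (Ring.inverse P')) := by
        rw [← hinv]
        exact add_le_add (hτ.mono hQ' hP.nonneg le_rfl hQP')
          (hτ.mono hP'.nonneg hP.ringInverse.nonneg hQP le_rfl)
    _ ≤ algebraMap ℝ _ (b / a + (b / a)⁻¹) := by
        refine add_ringInverse_le (div_pos hb ha) ?_ ?_
        · rw [inv_div, div_eq_mul_inv, ← hτ.apply_algebraMap]
          exact hτ.mono (algebraMap_nonneg _ (inv_pos.2 hb).le) hP.nonneg haP
            (algebraMap_le_ringInverse hb hP' hPb')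
        · rw [div_eq_mul_inv, ← hτ.apply_algebraMap]
          exact hτ.mono hP'.ringInverse.nonneg (algebraMap_nonneg _ hb.le) hPb
            (ringInverse_le_algebraMap ha haP')
    _ = algebraMap ℝ _ (b / a + a / b) := by rw [inv_div]

theorem weighted_add_le (hτ : IsTensorMap τ) {κ : ℝ} {W W' P P' Q Q' : H →L[ℂ] H} (hW : 0 ≤ W)
    (hW' : 0 ≤ W') (h : τ P Q' + τ Q P' ≤ algebraMap ℝ _ κ) :
    τ (weighted W P) (weighted W' Q') + τ (weighted W Q) (weighted W' P') ≤ (κ : ℂ) • τ W W' := by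
  have hG : IsSelfAdjoint (τ (CFC.sqrt W) (CFC.sqrt W')) :=
    hτ.isSelfAdjoint (CFC.sqrt_nonneg W).isSelfAdjoint (CFC.sqrt_nonneg W').isSelfAdjoint
  have := hG.conjugate_le_conjugate h
  rwa [mul_add, add_mul, ← hτ.apply_weighted, ← hτ.apply_weighted, algebraMap_eq_coe_smul,
    mul_smul_comm, smul_mul_assoc, mul_one, ← hτ.map_mul, CFC.sqrt_mul_sqrt_self W,
    CFC.sqrt_mul_sqrt_self W'] at this

end IsTensorMap

/-! ### Measurability and integrability -/

/-- A finite regular measure is carried by a σ-compact set, on which a continuous function has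
separable range. No second countability is needed on either side. -/
theorem aestronglyMeasurable_of_continuous {Ω E : Type*} [TopologicalSpace Ω] [T2Space Ω]
    [MeasurableSpace Ω] [BorelSpace Ω] {μ : Measure Ω} [IsFiniteMeasure μ] [μ.Regular]
    [TopologicalSpace E] [TopologicalSpace.PseudoMetrizableSpace E] {g : Ω → E}
    (hg : Continuous g) : AEStronglyMeasurable g μ := by
  choose K _ hK hμK using fun n : ℕ => (MeasurableSet.univ (α := Ω)).exists_isCompact_sdiff_lt
    (measure_ne_top μ _) (ENNReal.inv_ne_zero.2 (ENNReal.natCast_ne_top (n + 1)))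
  have hnull : μ (⋃ n, K n)ᶜ = 0 := by
    refine le_antisymm (ge_of_tendsto' ((ENNReal.tendsto_inv_nat_nhds_zero).comp
      (tendsto_add_atTop_nat 1)) fun n => ?_) bot_le
    refine (measure_mono ?_).trans (hμK n).le
    rw [← Set.compl_eq_univ_sdiff, Set.compl_subset_compl]
    exact Set.subset_iUnion K n
  have h : AEStronglyMeasurable g (μ.restrict (⋃ n, K n)) :=
    AEStronglyMeasurable.iUnion fun n =>
      hg.continuousOn.aestronglyMeasurable_of_isCompact (hK n) (hK n).measurableSet
  have hmem : ∀ᵐ x ∂μ, x ∈ ⋃ n, K n := mem_ae_iff.2 hnull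
  rwa [Measure.restrict_eq_self_of_ae_mem hmem] at h

theorem continuous_sqrt_comp {X : Type*} [TopologicalSpace X] {A : X → H →L[ℂ] H}
    (hA : Continuous A) (hApos : ∀ t, 0 ≤ A t) : Continuous fun t => CFC.sqrt (A t) :=
  CFC.continuousOn_sqrt.comp_continuous hA hApos

theorem continuous_conjSqrt_comp {X : Type*} [TopologicalSpace X] {A T : X → H →L[ℂ] H}
    (hA : Continuous A) (hApos : ∀ t, 0 ≤ A t) (hT : Continuous T) :
    Continuous fun t => CFC.conjSqrt (A t) (T t) :=
  ((continuous_sqrt_comp hA hApos).mul hT).mul (continuous_sqrt_comp hA hApos)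

theorem continuous_ringInverse_comp {X : Type*} [TopologicalSpace X] {A : X → H →L[ℂ] H}
    (hA : Continuous A) (hApos : ∀ t, IsUnit (A t)) : Continuous fun t => Ring.inverse (A t) :=
  continuous_iff_continuousAt.2 fun t => by
    obtain ⟨u, hu⟩ := hApos t
    exact ContinuousAt.comp (f := A) (by rw [← hu]; exact NormedRing.inverse_continuousAt u)
      hA.continuousAt

/-- Norm continuity of the mean along fields whose spectra stay in a fixed compact subset of
`(0, ∞)`: the arguments of `f` then have spectra in the fixed interval `[a / b, b / a]`. -/
theorem IsRepresentingFunction.continuous_mean {X : Type*} [TopologicalSpace X]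
    (hf : IsRepresentingFunction σ f) (hσ : IsConnection σ) {a b : ℝ} (ha : 0 < a) (hb : 0 < b)
    {A B : X → H →L[ℂ] H} (hA : Continuous A) (hB : Continuous B)
    (haA : ∀ t, algebraMap ℝ _ a ≤ A t) (hAb : ∀ t, A t ≤ algebraMap ℝ _ b)
    (haB : ∀ t, algebraMap ℝ _ a ≤ B t) (hBb : ∀ t, B t ≤ algebraMap ℝ _ b) :
    Continuous fun t => σ (A t) (B t) := by
  have hApos t := isStrictlyPositive_of_algebraMap_le ha (haA t)
  have hBpos t := isStrictlyPositive_of_algebraMap_le ha (haB t)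
  have hscal : ∀ (C : H →L[ℂ] H) (r : ℝ), 0 ≤ C →
      CFC.conjSqrt C (algebraMap ℝ _ r) = r • C := fun C r hC => by
    rw [Algebra.algebraMap_eq_smul_one, map_smul, CFC.conjSqrt_one C hC]
  have hC : Continuous fun t => CFC.conjSqrt (Ring.inverse (A t)) (B t) :=
    continuous_conjSqrt_comp (continuous_ringInverse_comp hA fun t => (hApos t).isUnit)
      (fun t => (hApos t).ringInverse.nonneg) hB
  have hspec : ∀ t, spectrum ℝ (CFC.conjSqrt (Ring.inverse (A t)) (B t)) ⊆
      Set.Icc (a * b⁻¹) (b * a⁻¹) := fun t => by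
    have hi := (hApos t).ringInverse
    refine spectrum_subset_Icc_of_le
      ((CFC.isStrictlyPositive_conjSqrt_iff _ _ hi).2 (hBpos t)).nonneg.isSelfAdjoint ?_ ?_
    · refine le_trans ?_ (CFC.conjSqrt_le_conjSqrt (haB t))
      rw [hscal _ _ hi.nonneg, map_mul, ← Algebra.smul_def]
      exact smul_le_smul_of_nonneg_left (algebraMap_le_ringInverse hb (hApos t) (hAb t)) ha.le
    · refine (CFC.conjSqrt_le_conjSqrt (hBb t)).trans ?_
      rw [hscal _ _ hi.nonneg, map_mul, ← Algebra.smul_def]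
      exact smul_le_smul_of_nonneg_left (ringInverse_le_algebraMap ha (haA t)) hb.le
  have hfC : Continuous fun t => cfc f (CFC.conjSqrt (Ring.inverse (A t)) (B t)) :=
    hC.cfc' isCompact_Icc f hspec
      (hf.continuousOn.mono fun x hx => (show 0 ≤ a * b⁻¹ by positivity).trans hx.1)
      (fun t => ((CFC.isStrictlyPositive_conjSqrt_iff _ _ (hApos t).ringInverse).2
        (hBpos t)).nonneg.isSelfAdjoint)
  refine (continuous_conjSqrt_comp hA (fun t => (hApos t).nonneg) hfC).congr fun t => ?_
  exact (hf.apply_of_isStrictlyPositive hσ (hApos t) (hBpos t).nonneg).symm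

theorem norm_weighted_le {W T : H →L[ℂ] H} (hW : 0 ≤ W) {c : ℝ} (hT : ‖T‖ ≤ c) :
    ‖weighted W T‖ ≤ c * ‖W‖ := by
  calc ‖weighted W T‖ ≤ ‖CFC.sqrt W‖ * ‖T‖ * ‖CFC.sqrt W‖ :=
        (norm_mul_le _ _).trans (mul_le_mul_of_nonneg_right (norm_mul_le _ _) (norm_nonneg _))
    _ = ‖T‖ * ‖W‖ := by
        rw [CFC.norm_sqrt W, mul_comm (√‖W‖), mul_assoc, Real.mul_self_sqrt (norm_nonneg _)]
    _ ≤ c * ‖W‖ := mul_le_mul_of_nonneg_right hT (norm_nonneg _)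

theorem integrable_weighted {Ω : Type*} [TopologicalSpace Ω] [T2Space Ω]
    [MeasurableSpace Ω] [BorelSpace Ω] {μ : Measure Ω} [IsFiniteMeasure μ] [μ.Regular]
    {W T : Ω → H →L[ℂ] H} (hW : Continuous W) (hWpos : ∀ t, 0 ≤ W t)
    (hWint : Integrable (fun t => ‖W t‖) μ) (hT : Continuous T) {c : ℝ} (hTc : ∀ t, ‖T t‖ ≤ c) :
    Integrable (fun t => weighted (W t) (T t)) μ :=
  (hWint.const_mul c).mono' (aestronglyMeasurable_of_continuous
    (continuous_conjSqrt_comp hW hWpos hT)) (ae_of_all _ fun t => norm_weighted_le (hWpos t) (hTc t))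

/-- A pointwise inequality between symmetrized tensor products of fields passes to the integrals,
by integrating in one variable at a time. -/
theorem IsTensorMap.integral_le {K : Type*} [NormedAddCommGroup K] [InnerProductSpace ℂ K]
    [CompleteSpace K] {τ : (H →L[ℂ] H) → (H →L[ℂ] H) → (K →L[ℂ] K)} (hτ : IsTensorMap τ)
    {Ω : Type*} [MeasurableSpace Ω] {μ : Measure Ω}
    {X Y W : Ω → H →L[ℂ] H} (hX : Integrable X μ) (hY : Integrable Y μ) (hW : Integrable W μ)
    {κ : ℂ} (h : ∀ s t, τ (X s) (Y t) + τ (Y s) (X t) ≤ κ • τ (W s) (W t)) :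
    (1 / 2 : ℂ) • (τ (∫ t, X t ∂μ) (∫ t, Y t ∂μ) + τ (∫ t, Y t ∂μ) (∫ t, X t ∂μ)) ≤
      (1 / 2 * κ) • τ (∫ t, W t ∂μ) (∫ t, W t ∂μ) := by
  have int_right : ∀ (S : H →L[ℂ] H) {Z : Ω → H →L[ℂ] H}, Integrable Z μ →
      Integrable (fun t => τ S (Z t)) μ ∧
      ∫ t, τ S (Z t) ∂μ = τ S (∫ t, Z t ∂μ) := fun S Z hZ =>
    ⟨(hτ.right S).integrable_comp hZ, (hτ.right S).integral_comp_comm hZ⟩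
  have int_left : ∀ (S : H →L[ℂ] H) {Z : Ω → H →L[ℂ] H}, Integrable Z μ →
      Integrable (fun t => τ (Z t) S) μ ∧
      ∫ t, τ (Z t) S ∂μ = τ (∫ t, Z t ∂μ) S := fun S Z hZ =>
    ⟨(hτ.left S).integrable_comp hZ, (hτ.left S).integral_comp_comm hZ⟩
  have h₁ : ∀ s, τ (X s) (∫ t, Y t ∂μ) + τ (Y s) (∫ t, X t ∂μ) ≤
      κ • τ (W s) (∫ t, W t ∂μ) := fun s => by
    obtain ⟨i₁, e₁⟩ := int_right (X s) hY
    obtain ⟨i₂, e₂⟩ := int_right (Y s) hX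
    obtain ⟨i₃, e₃⟩ := int_right (W s) hW
    rw [← e₁, ← e₂, ← e₃, ← integral_add i₁ i₂, ← integral_smul]
    exact integral_mono (i₁.add i₂) (i₃.smul κ) (h s)
  have h₂ : τ (∫ t, X t ∂μ) (∫ t, Y t ∂μ) + τ (∫ t, Y t ∂μ) (∫ t, X t ∂μ) ≤
      κ • τ (∫ t, W t ∂μ) (∫ t, W t ∂μ) := by
    obtain ⟨i₁, e₁⟩ := int_left (∫ t, Y t ∂μ) hX
    obtain ⟨i₂, e₂⟩ := int_left (∫ t, X t ∂μ) hY
    obtain ⟨i₃, e₃⟩ := int_left (∫ t, W t ∂μ) hW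
    rw [← e₁, ← e₂, ← e₃, ← integral_add i₁ i₂, ← integral_smul]
    exact integral_mono (i₁.add i₂) (i₃.smul κ) h₁
  have hhalf : (1 / 2 : ℂ) = ((1 / 2 : ℝ) : ℂ) := by norm_num
  rw [mul_smul, hhalf, Complex.coe_smul, Complex.coe_smul]
  exact smul_le_smul_of_nonneg_left h₂ (by norm_num)

end KantorovichMean

theorem theorem4p4
    {H : Type*} [NormedAddCommGroup H] [InnerProductSpace ℂ H] [CompleteSpace H]
    {Ω : Type*} [TopologicalSpace Ω] [LocallyCompactSpace Ω] [T2Space Ω]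
    [MeasurableSpace Ω] [BorelSpace Ω]
    (μ : Measure Ω) [IsFiniteMeasure μ] [μ.Regular]
    (a b : ℝ) (ha : 0 < a) (hab : a ≤ b)
    (A B W : Ω → H →L[ℂ] H)
    (hA : Continuous A) (hApos : ∀ t, IsStrictlyPositive (A t))
    (hAspec : ∀ t, spectrum ℝ (A t) ⊆ Set.Icc a b)
    (hB : Continuous B) (hBpos : ∀ t, IsStrictlyPositive (B t))
    (hBspec : ∀ t, spectrum ℝ (B t) ⊆ Set.Icc a b)
    (hW : Continuous W) (hWpos : ∀ t, 0 ≤ W t) (hWint : Integrable (fun t => ‖W t‖) μ)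
    (σ : (H →L[ℂ] H) → (H →L[ℂ] H) → (H →L[ℂ] H))
    (hσ : KantorovichMean.IsOperatorMean σ)
    (f : ℝ → ℝ) (hf : KantorovichMean.IsRepresentingFunction σ f)
    (hfsm : KantorovichMean.SuperMultiplicative f) :
    Integrable W μ ∧
    Integrable (fun t => KantorovichMean.weighted (W t) (σ (A t) (B t))) μ ∧
    Integrable (fun t => KantorovichMean.weighted (W t)
      (σ (Ring.inverse (A t)) (Ring.inverse (B t)))) μ ∧
    KantorovichMean.symTensor
        (∫ t, KantorovichMean.weighted (W t) (σ (A t) (B t)) ∂μ)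
        (∫ t, KantorovichMean.weighted (W t)
          (σ (Ring.inverse (A t)) (Ring.inverse (B t))) ∂μ) ≤
      (((a ^ 2 + b ^ 2) / (2 * a * b) : ℝ) : ℂ) •
        KantorovichMean.opTensor (∫ t, W t ∂μ) (∫ t, W t ∂μ) := by
  open KantorovichMean in
  have hb : 0 < b := ha.trans_le hab
  have bounds : ∀ {T : H →L[ℂ] H}, IsStrictlyPositive T → spectrum ℝ T ⊆ Set.Icc a b →
      algebraMap ℝ _ a ≤ T ∧ T ≤ algebraMap ℝ _ b := fun hT hs =>
    ⟨(algebraMap_le_iff_le_spectrum hT.nonneg.isSelfAdjoint).2 fun x hx => (hs hx).1,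
      (le_algebraMap_iff_spectrum_le hT.nonneg.isSelfAdjoint).2 fun x hx => (hs hx).2⟩
  have bA t := bounds (hApos t) (hAspec t)
  have bB t := bounds (hBpos t) (hBspec t)
  have bAi t := And.intro (algebraMap_le_ringInverse hb (hApos t) (bA t).2)
    (ringInverse_le_algebraMap ha (bA t).1)
  have bBi t := And.intro (algebraMap_le_ringInverse hb (hBpos t) (bB t).2)
    (ringInverse_le_algebraMap ha (bB t).1)
  have bP t := hσ.bounds ha.le (bA t).1 (bA t).2 (bB t).1 (bB t).2
  have bQ t := hσ.bounds (inv_pos.2 hb).le (bAi t).1 (bAi t).2 (bBi t).1 (bBi t).2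
  have hP t := isStrictlyPositive_of_algebraMap_le ha (bP t).1
  have hQ t := isStrictlyPositive_of_algebraMap_le (inv_pos.2 hb) (bQ t).1
  have cP : Continuous fun t => σ (A t) (B t) :=
    hf.continuous_mean hσ.toIsConnection ha hb hA hB (fun t => (bA t).1) (fun t => (bA t).2)
      (fun t => (bB t).1) (fun t => (bB t).2)
  have cQ : Continuous fun t => σ (Ring.inverse (A t)) (Ring.inverse (B t)) :=
    hf.continuous_mean hσ.toIsConnection (inv_pos.2 hb) (inv_pos.2 ha)
      (continuous_ringInverse_comp hA fun t => (hApos t).isUnit)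
      (continuous_ringInverse_comp hB fun t => (hBpos t).isUnit)
      (fun t => (bAi t).1) (fun t => (bAi t).2) (fun t => (bBi t).1) (fun t => (bBi t).2)
  have iW : Integrable W μ := (integrable_norm_iff (aestronglyMeasurable_of_continuous hW)).1 hWint
  have iX := integrable_weighted hW hWpos hWint cP fun t =>
    (CStarAlgebra.norm_le_iff_le_algebraMap _ hb.le (hP t).nonneg).2 (bP t).2
  have iY := integrable_weighted hW hWpos hWint cQ fun t =>
    (CStarAlgebra.norm_le_iff_le_algebraMap _ (inv_pos.2 ha).le (hQ t).nonneg).2 (bQ t).2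
  refine ⟨iW, iX, iY, ?_⟩
  have hQP t := hf.mean_ringInverse_le hσ hfsm (hApos t) (hBpos t) (hP t)
  -- The constant `b / a + a / b` is halved by the factor `1 / 2` of the symmetrized product.
  have key := isTensorMap_opTensor.integral_le iX iY iW fun s t =>
    isTensorMap_opTensor.weighted_add_le (hWpos s) (hWpos t)
      (isTensorMap_opTensor.add_le_algebraMap ha hb (bP s).1 (bP s).2 (bP t).1 (bP t).2
        (hQP s) (hQ t).nonneg (hQP t))
  have hκ : (1 / 2 * ((b / a + a / b : ℝ) : ℂ)) = ((a ^ 2 + b ^ 2) / (2 * a * b) : ℝ) := by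
    push_cast
    have : (a : ℂ) ≠ 0 := by exact_mod_cast ha.ne'
    have : (b : ℂ) ≠ 0 := by exact_mod_cast hb.ne'
    field_simp
    ring
  rw [hκ] at key
  exact key
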